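/- Let $f,g:\mathbb{R}^n\to\mathbb{R}\cup\{+\infty\}$ be proper, lower semicontinuous and convex, and let $f$ be standard self-concordant: $\operatorname{dom} f$ is open, $f$ is $C^3$ on it, and for all $x\in\operatorname{dom} f$, $v\in\mathbb{R}^n$ the function $\varphi(t)=f(x+tv)$ satisfies $|\varphi'''(t)|\le 2\varphi''(t)^{3/2}$ whenever $x+tv\in\operatorname{dom} f$. Put $F=f+g$ and $\|v\|_x=(v^T\nabla^2 f(x)v)^{1/2}$, and assume that $x^*$ is the unique minimizer of $F$ over $\mathbb{R}^n$. Let $\sigma=0.2$, and let $0<\varepsilon<0.28$ be such that $1.5\ln\ln(0.28/\varepsilon)\ge -1$ (that is, $0<\varepsilon\le 0.28\,e^{-e^{-2/3}}\approx 0.167$). Consider the two-phase proximal-Newton algorithm started at $x^0\in\operatorname{dom} F$: at iteration $k=0,1,2,\dots$ let $$s^k\in\arg\min_{y\in\mathbb{R}^n}\Big\{g(y)+\tfrac12 y^T\nabla^2 f(x^k)y-\big(\nabla^2 f(x^k)x^k-\nabla f(x^k)\big)^Ty\Big\}$$ (a solution is assumed to exist at each iteration that is reached; any solution may be taken), $d^k=s^k-x^k$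 and $\lambda_k=\|d^k\|_{x^k}$. If $\lambda_k>\sigma$, set $x^{k+1}=x^k+(1+\lambda_k)^{-1}d^k$; otherwise, if $\lambda_k>\varepsilon$, set $x^{k+1}=x^k+d^k$; otherwise stop. Then all the iterates lie in $\operatorname{dom} F$, and the algorithm stops at some iteration $k$ with $$k\le K_{\max}:=\left\lfloor\frac{F(x^0)-F(x^*)}{0.017}\right\rfloor+\left\lfloor 1.5\ln\ln\frac{0.28}{\varepsilon}\right\rfloor+2 ,$$ and at that iteration $\lambda_k\le\varepsilon$ and $\|x^k-x^*\|_{x^*}\le 2\varepsilon$. -/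

import Mathlib

namespace ProxNewton

/-- `ℝⁿ` with its Euclidean inner product. -/
abbrev Vec (n : ℕ) : Type := EuclideanSpace ℝ (Fin n)

/-- Effective domain `{x | f x < +∞}` of an extended-real-valued function. -/
def dom {n : ℕ} (f : Vec n → EReal) : Set (Vec n) := {x | f x < ⊤}

/-- Proper, lower semicontinuous (closed) convex functions `ℝⁿ → ℝ ∪ {+∞}`;
convexity is convexity of the epigraph. -/
structure IsProperClosedConvex {n : ℕ} (f : Vec n → EReal) : Prop where
  ne_bot : ∀ x, f x ≠ ⊥
  dom_nonempty : (dom f).Nonempty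
  lsc : LowerSemicontinuous f
  convex_epigraph : Convex ℝ {p : Vec n × ℝ | f p.1 ≤ (p.2 : EReal)}

/-- The finite values of `f` (only meaningful on `dom f`). -/
noncomputable def finiteValue {n : ℕ} (f : Vec n → EReal) : Vec n → ℝ := fun x => (f x).toReal

/-- Self-concordant functions with parameter `M`: closed convex functions, three times continuously
differentiable on their open domain, whose restrictions `φ(t) = f (x + t v)` to lines satisfy
`|φ'''(t)| ≤ M φ''(t)^{3/2}` wherever `x + t v ∈ dom f`. -/
structure IsSelfConcordant {n : ℕ} (M : ℝ) (f : Vec n → EReal) : Prop where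
  closedConvex : IsProperClosedConvex f
  isOpen_dom : IsOpen (dom f)
  contDiffOn : ContDiffOn ℝ 3 (finiteValue f) (dom f)
  third_le : ∀ x ∈ dom f, ∀ v : Vec n, ∀ t : ℝ, x + t • v ∈ dom f →
    |iteratedDeriv 3 (fun τ : ℝ => finiteValue f (x + τ • v)) t| ≤
      M * (iteratedDeriv 2 (fun τ : ℝ => finiteValue f (x + τ • v)) t) ^ (3 / 2 : ℝ)

/-- The gradient `∇f(x)`. -/
noncomputable def grad {n : ℕ} (f : Vec n → EReal) (x : Vec n) : Vec n :=
  gradient (finiteValue f) x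

/-- The Hessian `∇²f(x)`, as a linear operator on `ℝⁿ`. -/
noncomputable def hess {n : ℕ} (f : Vec n → EReal) (x : Vec n) : Vec n →L[ℝ] Vec n :=
  fderiv ℝ (grad f) x

/-- The local norm `‖v‖ₓ = (vᵀ ∇²f(x) v)^{1/2}`. -/
noncomputable def localNorm {n : ℕ} (f : Vec n → EReal) (x v : Vec n) : ℝ :=
  √(inner ℝ v (hess f x v))

/-- The set `argmin_y { g(y) + ½ yᵀ H y - uᵀ y }`, the values of the proximity operator
`P^g_H(u)`. -/
def proxSet {n : ℕ} (g : Vec n → EReal) (H : Vec n →L[ℝ] Vec n) (u : Vec n) : Set (Vec n) :=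
  {y | ∀ z, g y + (((1 / 2 : ℝ) * inner ℝ y (H y) - inner ℝ u y : ℝ) : EReal) ≤
            g z + (((1 / 2 : ℝ) * inner ℝ z (H z) - inner ℝ u z : ℝ) : EReal)}

/-- The solutions `s` of the proximal-Newton subproblem at `x`:
`P^g_{∇²f(x)} (∇²f(x) x - ∇f(x))`. -/
def newtonSet {n : ℕ} (f g : Vec n → EReal) (x : Vec n) : Set (Vec n) :=
  proxSet g (hess f x) (hess f x x - grad f x)

/-- The composite objective `F = f + g`. -/
noncomputable def objective {n : ℕ} (f g : Vec n → EReal) : Vec n → EReal := fun x => f x + g x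

/-- `xs` is the unique minimizer of `F` over `ℝⁿ`. -/
def IsUniqueMinimizer {n : ℕ} (F : Vec n → EReal) (xs : Vec n) : Prop :=
  (∀ y, F xs ≤ F y) ∧ ∀ y, (∀ z, F y ≤ F z) → y = xs

/-- The proximal-Newton decrement `λ_k = ‖d^k‖_{x^k}`, `d^k = s^k - x^k`. -/
noncomputable def decrement {n : ℕ} (f : Vec n → EReal) (x s : ℕ → Vec n) (k : ℕ) : ℝ :=
  localNorm f (x k) (s k - x k)

/-- The algorithm stops at iteration `k`: neither `λ_k > σ` nor `λ_k > ε`. -/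
def StopsAt {n : ℕ} (f : Vec n → EReal) (σ ε : ℝ) (x s : ℕ → Vec n) (k : ℕ) : Prop :=
  ¬ σ < decrement f x s k ∧ ¬ ε < decrement f x s k

/-- `(x, s)` is a run of the two-phase proximal-Newton algorithm from `x 0`: at every iteration
that is reached, `s k` is some solution of the subproblem at `x k`; a damped step is taken if
`λ_k > σ`, otherwise a full step if `λ_k > ε`, otherwise the algorithm stops (nothing is required
of the sequences from then on). -/
structure IsRun {n : ℕ} (f g : Vec n → EReal) (σ ε : ℝ) (x s : ℕ → Vec n) : Prop where
  start : x 0 ∈ dom (objective f g)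
  subproblem : ∀ k, (∀ j < k, ¬ StopsAt f σ ε x s j) → s k ∈ newtonSet f g (x k)
  damped : ∀ k, (∀ j < k, ¬ StopsAt f σ ε x s j) → σ < decrement f x s k →
    x (k + 1) = x k + (1 + decrement f x s k)⁻¹ • (s k - x k)
  full : ∀ k, (∀ j < k, ¬ StopsAt f σ ε x s j) → ¬ σ < decrement f x s k →
    ε < decrement f x s k → x (k + 1) = x k + (s k - x k)

/-- `K_max = ⌊(F(x⁰) - F(x*)) / 0.017⌋ + ⌊1.5 ln ln (0.28 / ε)⌋ + 2`, with `gap = F(x⁰) - F(x*)`. -/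
noncomputable def Kmax (gap ε : ℝ) : ℤ :=
  ⌊gap / 0.017⌋ + ⌊1.5 * Real.log (Real.log (0.28 / ε))⌋ + 2

end ProxNewton

open ProxNewton

/-! Self-concordance bounds the third derivative only on the diagonal. The Bernstein-Szegő
inequality for binary cubic forms polarizes this without loss, giving |D³f[v,u,u]| ≤ 2‖v‖‖u‖²
(`abs_thirdDeriv_le`). Integrating along a segment with r = ‖v‖ₓ < 1 compares the Hessians at x and
x + tv up to the factor (1 - tr)², bounds f and the error of linearizing its gradient, and places
the open unit Dikin ellipsoid inside the domain.

These estimates meet the variational inequalities of the subproblem and of the minimizer. A damped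
step lowers F by λ - ln(1 + λ) > 0.017 (`damped_step`), so at most gap / 0.017 of them occur. A full
step gives λ⁺ ≤ (λ/(1 - λ))² (`full_step_decrement_le`): once λ ≤ 0.2 it stays so, and 1.5625 λ is
at least squared away at each step, whence the ln ln count. Strong monotonicity of the gradient
turns the final λ ≤ ε into the distance bound (`localNorm_sub_minimizer_le`).

The Hessian may be degenerate, so ratios of local norms are kept multiplied out or regularized by δ
> 0. -/

namespace ProxNewton

/-! ### Polarization of cubic forms. -/

/-- A quadrature formula for the first polar form of a binary cubic form, with nodes at the three
angles `γ + 2πk/3`. -/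
lemma cubic_polar_quadrature {c s r : ℝ} (hcs : c ^ 2 + s ^ 2 = 1) (hr : r ^ 2 = 3)
    (t₀ t₁ t₂ t₃ : ℝ) (P : ℝ → ℝ → ℝ)
    (hP : ∀ a b, P a b = t₀ * a ^ 3 + 3 * t₁ * a ^ 2 * b + 3 * t₂ * a * b ^ 2 + t₃ * b ^ 3) :
    t₀ * (4 * c ^ 3 - 3 * c) + t₁ * (3 * s - 4 * s ^ 3) =
      (4 * c ^ 2 - 1) ^ 2 / 9 * P c s +
      (4 * (-(c + r * s) / 2) ^ 2 - 1) ^ 2 / 9 * P (-(c + r * s) / 2) ((r * c - s) / 2) +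
      (4 * ((r * s - c) / 2) ^ 2 - 1) ^ 2 / 9 * P ((r * s - c) / 2) (-(r * c + s) / 2) := by
  simp only [hP]
  have h4 : r ^ 4 = 9 := by rw [show r ^ 4 = (r ^ 2) ^ 2 by ring, hr]; norm_num
  have h6 : r ^ 6 = 27 := by rw [show r ^ 6 = (r ^ 2) ^ 3 by ring, hr]; norm_num
  grind

/-- The Bernstein-Szegő inequality for binary cubic forms. -/
lemma abs_cubic_polar_le {M : ℝ} (t₀ t₁ t₂ t₃ : ℝ)
    (h : ∀ a b : ℝ, a ^ 2 + b ^ 2 = 1 →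
      |t₀ * a ^ 3 + 3 * t₁ * a ^ 2 * b + 3 * t₂ * a * b ^ 2 + t₃ * b ^ 3| ≤ M) (X Y : ℝ) :
    |t₀ * X + t₁ * Y| ≤ M * √(X ^ 2 + Y ^ 2) := by
  set P : ℝ → ℝ → ℝ := fun a b =>
    t₀ * a ^ 3 + 3 * t₁ * a ^ 2 * b + 3 * t₂ * a * b ^ 2 + t₃ * b ^ 3 with hP
  have key : ∀ c s : ℝ, c ^ 2 + s ^ 2 = 1 →
      |t₀ * (4 * c ^ 3 - 3 * c) + t₁ * (3 * s - 4 * s ^ 3)| ≤ M := by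
    intro c s hcs
    have hr : (√3 : ℝ) ^ 2 = 3 := Real.sq_sqrt (by norm_num)
    generalize √3 = r at hr
    have hq := cubic_polar_quadrature hcs hr t₀ t₁ t₂ t₃ P (fun _ _ => rfl)
    -- The weights are Fejér kernel values (sin 3θ / (3 sin θ))² at the three nodes: nonnegative
    -- with sum 1, so the polar value is a convex combination of values of P on the circle.
    have hsum : (4 * c ^ 2 - 1) ^ 2 / 9 + (4 * (-(c + r * s) / 2) ^ 2 - 1) ^ 2 / 9 +
        (4 * ((r * s - c) / 2) ^ 2 - 1) ^ 2 / 9 = 1 := by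
      clear hq
      grind
    rw [hq]
    have h1 := h c s hcs
    have h2 := h (-(c + r * s) / 2) ((r * c - s) / 2) (by clear hq hsum; grind)
    have h3 := h ((r * s - c) / 2) (-(r * c + s) / 2) (by clear hq hsum; grind)
    change |P _ _| ≤ M at h1 h2 h3
    generalize P c s = p₁ at *
    generalize P (-(c + r * s) / 2) ((r * c - s) / 2) = p₂ at *
    generalize P ((r * s - c) / 2) (-(r * c + s) / 2) = p₃ at *
    have n1 : 0 ≤ (4 * c ^ 2 - 1) ^ 2 / 9 := by positivity
    have n2 : 0 ≤ (4 * (-(c + r * s) / 2) ^ 2 - 1) ^ 2 / 9 := by positivity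
    have n3 : 0 ≤ (4 * ((r * s - c) / 2) ^ 2 - 1) ^ 2 / 9 := by positivity
    generalize (4 * c ^ 2 - 1) ^ 2 / 9 = w₁ at *
    generalize (4 * (-(c + r * s) / 2) ^ 2 - 1) ^ 2 / 9 = w₂ at *
    generalize (4 * ((r * s - c) / 2) ^ 2 - 1) ^ 2 / 9 = w₃ at *
    rw [abs_le] at *
    obtain rfl : w₁ = 1 - w₂ - w₃ := by linarith
    constructor
    · nlinarith [mul_le_mul_of_nonneg_left h1.1 n1, mul_le_mul_of_nonneg_left h2.1 n2,
        mul_le_mul_of_nonneg_left h3.1 n3]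
    · nlinarith [mul_le_mul_of_nonneg_left h1.2 n1, mul_le_mul_of_nonneg_left h2.2 n2,
        mul_le_mul_of_nonneg_left h3.2 n3]
  -- In polar coordinates, `key` at a third of the argument gives the claim by the triple-angle
  -- formulas.
  set z : ℂ := ⟨X, Y⟩
  have hz : ‖z‖ = √(X ^ 2 + Y ^ 2) := by
    rw [Complex.norm_def, Complex.normSq_apply]; simp [z, sq]
  have hX : X = ‖z‖ * Real.cos z.arg := (Complex.norm_mul_cos_arg z).symm
  have hY : Y = ‖z‖ * Real.sin z.arg := (Complex.norm_mul_sin_arg z).symm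
  have hk := key (Real.cos (z.arg / 3)) (Real.sin (z.arg / 3)) (Real.cos_sq_add_sin_sq _)
  rw [← Real.cos_three_mul, ← Real.sin_three_mul, mul_div_cancel₀ _ (by norm_num)] at hk
  rw [← hz]
  calc |t₀ * X + t₁ * Y| = |t₀ * Real.cos z.arg + t₁ * Real.sin z.arg| * ‖z‖ := by
        conv_rhs => rw [← abs_of_nonneg (norm_nonneg z), ← abs_mul]
        congr 1
        rw [hX, hY]
        simp only [← hX, ← hY]
        linear_combination t₀ * hX + t₁ * hY
    _ ≤ M * ‖z‖ := by gcongr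

/-- A quadratic form dominated by a positive semidefinite one obeys a Cauchy-Schwarz inequality. -/
lemma abs_apply_le_of_abs_apply_self_le {E : Type*} [NormedAddCommGroup E] [NormedSpace ℝ E]
    (A B : E →L[ℝ] E →L[ℝ] ℝ) (hA : ∀ u v, A u v = A v u) (hB : ∀ u v, B u v = B v u)
    (hpos : ∀ u, 0 ≤ A u u) {c : ℝ} (hc : 0 ≤ c) (h : ∀ u, |B u u| ≤ c * A u u) (u v : E) :
    |B u v| ≤ c * (√(A u u) * √(A v v)) := by
  -- The difference of the values of B at tu + v and tu - v is 4t B(u,v), while those of A add up by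
  -- the parallelogram law; so this quadratic in t is nonnegative.
  have hd := discrim_le_zero (a := c * A u u) (b := 2 * B u v) (c := c * A v v) (fun t => by
    have h1 := (abs_le.1 (h (t • u + v))).1
    have h2 := (abs_le.1 (h (t • u - v))).2
    simp only [map_add, map_sub, map_smul, _root_.add_apply,
      _root_.sub_apply, _root_.smul_apply, smul_eq_mul] at h1 h2
    rw [hB v u, hA v u] at h1 h2
    nlinarith)
  rw [discrim] at hd
  apply abs_le_of_sq_le_sq _ (by positivity)
  rw [mul_pow, mul_pow, Real.sq_sqrt (hpos u), Real.sq_sqrt (hpos v)]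
  nlinarith

/-- The diagonal bound on a symmetric trilinear form, relative to a positive semidefinite form,
controls its partial polarization with the same constant. -/
lemma abs_trilinear_le {E : Type*} [NormedAddCommGroup E] [NormedSpace ℝ E]
    (A : E →L[ℝ] E →L[ℝ] ℝ) (T : E →L[ℝ] E →L[ℝ] E →L[ℝ] ℝ) (hA : ∀ u v, A u v = A v u)
    (hpos : ∀ u, 0 ≤ A u u) (hT₁ : ∀ u v w, T u v w = T v u w) (hT₂ : ∀ u v w, T u v w = T u w v)
    {M : ℝ} (hM : 0 ≤ M) (h : ∀ w, |T w w w| ≤ M * √(A w w) ^ 3) (u v : E) :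
    |T v u u| ≤ M * √(A v v) * A u u := by
  set p := A u u with hp
  -- Coefficient of the A-orthogonal projection of v on u. If p = 0 then a = 0 by convention, and
  -- `hap` survives because Cauchy-Schwarz forces A(u,v) = 0.
  set a := A u v / p with ha
  set e := v - a • u with he
  set q := A e e with hq
  have hpn : 0 ≤ p := hpos u
  have hap : a * p = A u v := by
    rcases eq_or_ne p 0 with h0 | h0
    · have := abs_apply_le_of_abs_apply_self_le A A hA hA hpos zero_le_one
        (fun u => by rw [abs_of_nonneg (hpos u), one_mul]) u v
      rw [← hp, h0] at this
      simp at this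
      rw [h0, this, mul_zero]
    · rw [ha]; field_simp
  have hue : A u e = 0 := by
    simp only [he, map_sub, map_smul, smul_eq_mul, ← hp]; linarith
  have heu : A e u = 0 := by rw [hA, hue]
  have hve : v = a • u + e := by rw [he]; abel
  have hvv : A v v = a ^ 2 * p + q := by
    rw [hve]
    simp only [map_add, map_smul, _root_.add_apply,
      _root_.smul_apply, smul_eq_mul, hue, heu, ← hp, ← hq]
    ring
  -- With δ > 0 the vectors u/ρ and e/κ make sense for degenerate A. In these coordinates
  -- T[v,u,u]/ρ² is the polar value of a binary cubic at (aρ, κ).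
  have hbound : ∀ δ : ℝ, 0 < δ →
      |T v u u| ≤ M * √(a ^ 2 * (p + δ) + (q + δ)) * (p + δ) := by
    intro δ hδ
    have hqn : 0 ≤ q := hpos e
    have hρ : 0 < √(p + δ) := Real.sqrt_pos.2 (by linarith)
    have hκ : 0 < √(q + δ) := Real.sqrt_pos.2 (by linarith)
    have hρ2 : √(p + δ) ^ 2 = p + δ := Real.sq_sqrt (by linarith)
    have hκ2 : √(q + δ) ^ 2 = q + δ := Real.sq_sqrt (by linarith)
    generalize √(p + δ) = ρ at *
    generalize √(q + δ) = κ at *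
    have h3 := abs_cubic_polar_le (M := M) (T u u u / ρ ^ 3) (T u u e / (ρ ^ 2 * κ))
      (T u e e / (ρ * κ ^ 2)) (T e e e / κ ^ 3) (fun x y hxy => by
        have hw := h ((x / ρ) • u + (y / κ) • e)
        have hA1 : A ((x / ρ) • u + (y / κ) • e) ((x / ρ) • u + (y / κ) • e) ≤ 1 := by
          simp only [map_add, map_smul, _root_.add_apply,
            _root_.smul_apply, smul_eq_mul, hue, heu, ← hp, ← hq]
          have e1 : p / ρ ^ 2 ≤ 1 := by rw [div_le_one (by positivity)]; linarith
          have e2 : q / κ ^ 2 ≤ 1 := by rw [div_le_one (by positivity)]; linarith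
          calc _ = x ^ 2 * (p / ρ ^ 2) + y ^ 2 * (q / κ ^ 2) := by field_simp; ring
            _ ≤ x ^ 2 * 1 + y ^ 2 * 1 := by gcongr
            _ = 1 := by linarith
        have hs : √(A ((x / ρ) • u + (y / κ) • e) ((x / ρ) • u + (y / κ) • e)) ^ 3 ≤ 1 :=
          pow_le_one₀ (Real.sqrt_nonneg _) (Real.sqrt_le_one.2 hA1)
        have hle := hw.trans (mul_le_mul_of_nonneg_left hs hM)
        rw [mul_one] at hle
        refine (congrArg abs ?_).trans_le hle
        simp only [map_add, map_smul, _root_.add_apply,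
          _root_.smul_apply, smul_eq_mul]
        rw [hT₁ e u u, hT₂ u e u, hT₂ e e u, hT₁ e u e]
        field_simp
        ring) (a * ρ) κ
    have hid : T v u u = ρ ^ 2 * (T u u u / ρ ^ 3 * (a * ρ) + T u u e / (ρ ^ 2 * κ) * κ) := by
      conv_lhs => rw [hve]
      simp only [map_add, map_smul, _root_.add_apply,
        _root_.smul_apply, smul_eq_mul]
      rw [hT₁ e u u, hT₂ u e u]
      field_simp
    rw [hid, abs_mul, abs_of_nonneg (sq_nonneg ρ), ← hρ2, ← hκ2, ← mul_pow, mul_comm]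
    gcongr
  rw [hvv]
  have hcont : ContinuousWithinAt
      (fun δ : ℝ => M * √(a ^ 2 * (p + δ) + (q + δ)) * (p + δ)) (Set.Ioi 0) 0 := by
    apply Continuous.continuousWithinAt; fun_prop
  have := ge_of_tendsto hcont.tendsto (eventually_mem_nhdsWithin.mono fun δ hδ => hbound δ hδ)
  simpa using this

/-! ### Derivatives of f as multilinear forms. -/

section Derivatives

section LineDerivatives

variable {E F G H : Type*} [NormedAddCommGroup E] [NormedSpace ℝ E] [NormedAddCommGroup F]
  [NormedSpace ℝ F] [NormedAddCommGroup G] [NormedSpace ℝ G] [NormedAddCommGroup H]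
  [NormedSpace ℝ H] {x v : E} {t : ℝ}

lemma _root_.HasFDerivAt.hasDerivAt_comp_line {q : E → F} {q' : E →L[ℝ] F}
    (h : HasFDerivAt q q' (x + t • v)) : HasDerivAt (fun τ : ℝ => q (x + τ • v)) (q' v) t :=
  h.comp_hasDerivAt t (by simpa using ((hasDerivAt_id t).smul_const v).const_add x)

lemma _root_.HasFDerivAt.hasDerivAt_comp_line_apply {q : E → F →L[ℝ] G} {q' : E →L[ℝ] F →L[ℝ] G}
    (h : HasFDerivAt q q' (x + t • v)) (u : F) :
    HasDerivAt (fun τ : ℝ => q (x + τ • v) u) (q' v u) t := by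
  simpa using h.hasDerivAt_comp_line.clm_apply (hasDerivAt_const t u)

lemma _root_.HasFDerivAt.hasDerivAt_comp_line_apply₂ {q : E → F →L[ℝ] G →L[ℝ] H}
    {q' : E →L[ℝ] F →L[ℝ] G →L[ℝ] H} (h : HasFDerivAt q q' (x + t • v)) (u : F) (w : G) :
    HasDerivAt (fun τ : ℝ => q (x + τ • v) u w) (q' v u w) t := by
  simpa using (h.hasDerivAt_comp_line_apply u).clm_apply (hasDerivAt_const t w)

end LineDerivatives

variable {n : ℕ} {f g : Vec n → EReal}

lemma IsProperClosedConvex.coe_finiteValue (hf : IsProperClosedConvex f) {x : Vec n}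
    (hx : x ∈ dom f) : (finiteValue f x : EReal) = f x :=
  EReal.coe_toReal (ne_of_lt hx) (hf.ne_bot x)

lemma IsProperClosedConvex.le_coe_combo (hf : IsProperClosedConvex f) {x y : Vec n}
    (hx : x ∈ dom f) (hy : y ∈ dom f) {a b : ℝ} (ha : 0 ≤ a) (hb : 0 ≤ b) (hab : a + b = 1) :
    f (a • x + b • y) ≤ ((a * finiteValue f x + b * finiteValue f y : ℝ) : EReal) := by
  have := hf.convex_epigraph (x := (x, finiteValue f x)) (y := (y, finiteValue f y))
    (hf.coe_finiteValue hx).ge (hf.coe_finiteValue hy).ge ha hb hab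
  simpa using this

lemma IsProperClosedConvex.convexOn (hf : IsProperClosedConvex f) :
    ConvexOn ℝ (dom f) (finiteValue f) := by
  have hd : Convex ℝ (dom f) := fun x hx y hy a b ha hb hab =>
    (hf.le_coe_combo hx hy ha hb hab).trans_lt (EReal.coe_lt_top _)
  refine ⟨hd, fun x hx y hy a b ha hb hab => ?_⟩
  have := hf.le_coe_combo hx hy ha hb hab
  rw [← hf.coe_finiteValue (hd hx hy ha hb hab)] at this
  exact_mod_cast this

/-- The second derivative of the finite part of `f`, as a bilinear form. -/
noncomputable def secondDeriv (f : Vec n → EReal) (x : Vec n) : Vec n →L[ℝ] Vec n →L[ℝ] ℝ :=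
  fderiv ℝ (fderiv ℝ (finiteValue f)) x

/-- The third derivative of the finite part of `f`, as a trilinear form. -/
noncomputable def thirdDeriv (f : Vec n → EReal) (x : Vec n) :
    Vec n →L[ℝ] Vec n →L[ℝ] Vec n →L[ℝ] ℝ :=
  fderiv ℝ (secondDeriv f) x

lemma inner_grad (x u : Vec n) : inner ℝ (grad f x) u = fderiv ℝ (finiteValue f) x u := by
  simp [grad, gradient]

namespace IsSelfConcordant

variable {M : ℝ} {x v : Vec n} {t : ℝ}

lemma contDiffAt (hf : IsSelfConcordant M f) (hx : x ∈ dom f) : ContDiffAt ℝ 3 (finiteValue f) x :=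
  hf.contDiffOn.contDiffAt (hf.isOpen_dom.mem_nhds hx)

lemma contDiffAt_fderiv (hf : IsSelfConcordant M f) (hx : x ∈ dom f) :
    ContDiffAt ℝ 2 (fderiv ℝ (finiteValue f)) x :=
  (hf.contDiffAt hx).fderiv_right (m := 2) (by norm_num)

lemma contDiffAt_secondDeriv (hf : IsSelfConcordant M f) (hx : x ∈ dom f) :
    ContDiffAt ℝ 1 (secondDeriv f) x :=
  (hf.contDiffAt_fderiv hx).fderiv_right (m := 1) (by norm_num)

/-- `grad` is `fderiv` followed by the linear Riesz isometry, so the operator Hessian can be traded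
for `secondDeriv` from here on. -/
lemma inner_hess (hf : IsSelfConcordant M f) (hx : x ∈ dom f) (u v : Vec n) :
    inner ℝ u (hess f x v) = secondDeriv f x v u := by
  have h1 : HasFDerivAt (fderiv ℝ (finiteValue f)) (secondDeriv f x) x :=
    ((hf.contDiffAt_fderiv hx).differentiableAt (by norm_num)).hasFDerivAt
  have h2 := ((InnerProductSpace.toDual ℝ (Vec n)).symm.toContinuousLinearEquiv
    |>.toContinuousLinearMap.hasFDerivAt (x := fderiv ℝ (finiteValue f) x)).comp x h1
  have h3 : hess f x = _ := h2.fderiv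
  rw [h3, real_inner_comm]
  simp

lemma localNorm_eq (hf : IsSelfConcordant M f) (hx : x ∈ dom f) (v : Vec n) :
    localNorm f x v = √(secondDeriv f x v v) := by
  rw [localNorm, hf.inner_hess hx]

lemma secondDeriv_symm (hf : IsSelfConcordant M f) (hx : x ∈ dom f) (u v : Vec n) :
    secondDeriv f x u v = secondDeriv f x v u :=
  ((hf.contDiffAt hx).isSymmSndFDerivAt (by norm_num)) u v

lemma thirdDeriv_symm₁ (hf : IsSelfConcordant M f) (hx : x ∈ dom f) (u v w : Vec n) :
    thirdDeriv f x u v w = thirdDeriv f x v u w := by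
  have := ((hf.contDiffAt_fderiv hx).isSymmSndFDerivAt (by simp)) u v
  exact congrArg (fun L => L w) this

lemma hasFDerivAt_secondDeriv (hf : IsSelfConcordant M f) (hx : x ∈ dom f) :
    HasFDerivAt (secondDeriv f) (thirdDeriv f x) x :=
  ((hf.contDiffAt_secondDeriv hx).differentiableAt (by norm_num)).hasFDerivAt

lemma hasDerivAt_value (hf : IsSelfConcordant M f) (ht : x + t • v ∈ dom f) :
    HasDerivAt (fun τ : ℝ => finiteValue f (x + τ • v))
      (fderiv ℝ (finiteValue f) (x + t • v) v) t :=
  (((hf.contDiffAt ht).differentiableAt (by norm_num)).hasFDerivAt).hasDerivAt_comp_line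

lemma hasDerivAt_fderiv (hf : IsSelfConcordant M f) (ht : x + t • v ∈ dom f) (u : Vec n) :
    HasDerivAt (fun τ : ℝ => fderiv ℝ (finiteValue f) (x + τ • v) u)
      (secondDeriv f (x + t • v) v u) t :=
  (((hf.contDiffAt_fderiv ht).differentiableAt
    (by norm_num)).hasFDerivAt).hasDerivAt_comp_line_apply u

lemma hasDerivAt_secondDeriv (hf : IsSelfConcordant M f) (ht : x + t • v ∈ dom f) (u w : Vec n) :
    HasDerivAt (fun τ : ℝ => secondDeriv f (x + τ • v) u w)
      (thirdDeriv f (x + t • v) v u w) t :=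
  (hf.hasFDerivAt_secondDeriv ht).hasDerivAt_comp_line_apply₂ u w

/-- The second derivative is symmetric throughout a neighbourhood of x, so the symmetry can be
differentiated along the line in direction u. -/
lemma thirdDeriv_symm₂ (hf : IsSelfConcordant M f) (hx : x ∈ dom f) (u v w : Vec n) :
    thirdDeriv f x u v w = thirdDeriv f x u w v := by
  have hx' : x + (0 : ℝ) • u ∈ dom f := by simpa using hx
  have h1 := hf.hasDerivAt_secondDeriv hx' v w
  have h2 := hf.hasDerivAt_secondDeriv hx' w v
  have hev : (fun τ : ℝ => secondDeriv f (x + τ • u) v w) =ᶠ[nhds 0]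
      fun τ : ℝ => secondDeriv f (x + τ • u) w v := by
    have : ∀ᶠ τ : ℝ in nhds 0, x + τ • u ∈ dom f :=
      (hf.isOpen_dom.preimage (f := fun τ : ℝ => x + τ • u) (by fun_prop)).mem_nhds hx'
    filter_upwards [this] with τ hτ using hf.secondDeriv_symm hτ v w
  simpa using h1.unique (h2.congr_of_eventuallyEq hev)

lemma isOpen_line (hf : IsSelfConcordant M f) (x v : Vec n) : IsOpen {τ : ℝ | x + τ • v ∈ dom f} :=
  hf.isOpen_dom.preimage (by fun_prop)

lemma convex_line (h : Convex ℝ (dom f)) (x v : Vec n) : Convex ℝ {τ : ℝ | x + τ • v ∈ dom f} := by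
  intro a ha b hb p q hp hq hpq
  have := h ha hb hp hq hpq
  simp only [Set.mem_ofPred_eq] at *
  convert this using 1
  rw [smul_add, smul_add, add_add_add_comm, ← add_smul, hpq]
  simp [add_smul, mul_smul]

lemma iteratedDeriv_two_line (hf : IsSelfConcordant M f) (ht : x + t • v ∈ dom f) :
    iteratedDeriv 2 (fun τ : ℝ => finiteValue f (x + τ • v)) t = secondDeriv f (x + t • v) v v := by
  rw [iteratedDeriv_succ, iteratedDeriv_one]
  refine ((hf.hasDerivAt_fderiv ht v).congr_of_eventuallyEq ?_).deriv
  filter_upwards [(hf.isOpen_line x v).mem_nhds ht] with τ hτ using (hf.hasDerivAt_value hτ).deriv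

lemma iteratedDeriv_three_line (hf : IsSelfConcordant M f) (ht : x + t • v ∈ dom f) :
    iteratedDeriv 3 (fun τ : ℝ => finiteValue f (x + τ • v)) t =
      thirdDeriv f (x + t • v) v v v := by
  rw [iteratedDeriv_succ]
  refine ((hf.hasDerivAt_secondDeriv ht v v).congr_of_eventuallyEq ?_).deriv
  filter_upwards [(hf.isOpen_line x v).mem_nhds ht] with τ hτ using hf.iteratedDeriv_two_line hτ

lemma secondDeriv_nonneg (hf : IsSelfConcordant M f) (hx : x ∈ dom f) (v : Vec n) :
    0 ≤ secondDeriv f x v v := by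
  set S := {τ : ℝ | x + τ • v ∈ dom f}
  have h0 : x + (0 : ℝ) • v ∈ dom f := by simpa using hx
  have hS : IsOpen S := hf.isOpen_line x v
  have hc : ConvexOn ℝ S (fun τ : ℝ => finiteValue f (x + τ • v)) := by
    refine ⟨convex_line hf.closedConvex.convexOn.1 x v, fun a ha b hb p q hp hq hpq => ?_⟩
    have := hf.closedConvex.convexOn.2 ha hb hp hq hpq
    convert this using 2
    rw [smul_add, smul_add, add_add_add_comm, ← add_smul, hpq]
    simp [add_smul, mul_smul]
  have hm := hc.monotoneOn_deriv (fun τ hτ => (hf.hasDerivAt_value hτ).differentiableAt)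
  have hm' : MonotoneOn (fun τ : ℝ => fderiv ℝ (finiteValue f) (x + τ • v) v) S :=
    hm.congr fun τ hτ => (hf.hasDerivAt_value hτ).deriv
  have := hm'.derivWithin_nonneg (x := 0)
  rw [derivWithin_of_isOpen hS h0, (hf.hasDerivAt_fderiv h0 v).deriv] at this
  simpa using this

/-- The only use of `third_le`; all later estimates rest on this mixed form of it. -/
lemma abs_thirdDeriv_le (hf : IsSelfConcordant 2 f) (hx : x ∈ dom f) (v u : Vec n) :
    |thirdDeriv f x v u u| ≤ 2 * √(secondDeriv f x v v) * secondDeriv f x u u := by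
  refine abs_trilinear_le _ _ (hf.secondDeriv_symm hx) (hf.secondDeriv_nonneg hx)
    (hf.thirdDeriv_symm₁ hx) (hf.thirdDeriv_symm₂ hx) (by norm_num) (fun w => ?_) u v
  have h0 : x + (0 : ℝ) • w ∈ dom f := by simpa using hx
  have := hf.third_le x hx w 0 h0
  rw [hf.iteratedDeriv_two_line h0, hf.iteratedDeriv_three_line h0] at this
  simp only [zero_smul, add_zero] at this
  convert this using 2
  rw [Real.sqrt_eq_rpow, ← Real.rpow_natCast, ← Real.rpow_mul (hf.secondDeriv_nonneg hx w)]
  norm_num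

end IsSelfConcordant

end Derivatives

/-! ### Self-concordant estimates along segments. -/

section Estimates

/-- Replaces integration below: each bound comes from the sign of a derivative along the segment. -/
lemma le_of_hasDerivAt_nonneg {h h' : ℝ → ℝ} {a b : ℝ} (hab : a ≤ b)
    (hd : ∀ t ∈ Set.Icc a b, HasDerivAt h (h' t) t) (hn : ∀ t ∈ Set.Icc a b, 0 ≤ h' t) :
    h a ≤ h b := by
  refine monotoneOn_of_deriv_nonneg (convex_Icc a b)
    (fun t ht => (hd t ht).continuousAt.continuousWithinAt)
    (fun t ht => (hd t (interior_subset ht)).differentiableAt.differentiableWithinAt)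
    (fun t ht => ?_) (Set.left_mem_Icc.2 hab) (Set.right_mem_Icc.2 hab) hab
  rw [(hd t (interior_subset ht)).deriv]
  exact hn t (interior_subset ht)

/-- If `|a'| ≤ 2 a^{3/2}` then `a^{-1/2}` is `1`-Lipschitz; the division-free form also covers
zeros of `a`. -/
lemma abs_sqrt_sub_sqrt_le {a a' : ℝ → ℝ} {T : ℝ} (hT : 0 ≤ T)
    (hd : ∀ t ∈ Set.Icc 0 T, HasDerivAt a (a' t) t) (hn : ∀ t ∈ Set.Icc 0 T, 0 ≤ a t)
    (hle : ∀ t ∈ Set.Icc 0 T, |a' t| ≤ 2 * √(a t) * a t) :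
    |√(a 0) - √(a T)| ≤ T * (√(a T) * √(a 0)) := by
  have h0 : (0 : ℝ) ∈ Set.Icc 0 T := Set.left_mem_Icc.2 hT
  have hTm : T ∈ Set.Icc 0 T := Set.right_mem_Icc.2 hT
  -- The shift by δ keeps the differential inequality and makes (a + δ)^(-1/2) differentiable where
  -- a vanishes.
  have hδ : ∀ δ : ℝ, 0 < δ →
      |√(a 0 + δ) - √(a T + δ)| ≤ T * (√(a T + δ) * √(a 0 + δ)) := by
    intro δ hδ
    have hpos : ∀ t ∈ Set.Icc 0 T, 0 < √(a t + δ) := fun t ht =>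
      Real.sqrt_pos.2 (by linarith [hn t ht])
    have hc : ∀ t ∈ Set.Icc 0 T, HasDerivAt (fun τ => (√(a τ + δ))⁻¹)
        (-(a' t / (2 * √(a t + δ))) / √(a t + δ) ^ 2) t := fun t ht =>
      (((hd t ht).add_const δ).sqrt (by linarith [hn t ht])).inv (hpos t ht).ne'
    have hbd : ∀ t ∈ Set.Icc 0 T, ‖-(a' t / (2 * √(a t + δ))) / √(a t + δ) ^ 2‖ ≤ 1 := by
      intro t ht
      have hp := hpos t ht
      rw [Real.norm_eq_abs, abs_div, abs_neg, abs_div,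
        abs_of_pos (by positivity : 0 < 2 * √(a t + δ)),
        abs_of_pos (by positivity : 0 < √(a t + δ) ^ 2), div_div, div_le_one (by positivity)]
      refine (hle t ht).trans ?_
      have h1 : √(a t) ≤ √(a t + δ) := Real.sqrt_le_sqrt (by linarith)
      have h2 : a t ≤ √(a t + δ) ^ 2 := by rw [Real.sq_sqrt] <;> linarith [hn t ht]
      have := hn t ht
      gcongr
    have := Convex.norm_image_sub_le_of_norm_hasDerivWithin_le
      (fun t ht => (hc t ht).hasDerivWithinAt) hbd (convex_Icc 0 T) h0 hTm
    rw [Real.norm_eq_abs, Real.norm_eq_abs, sub_zero, abs_of_nonneg hT, one_mul] at this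
    have p0 := hpos 0 h0
    have pT := hpos T hTm
    have heq : √(a 0 + δ) - √(a T + δ) =
        ((√(a T + δ))⁻¹ - (√(a 0 + δ))⁻¹) * (√(a T + δ) * √(a 0 + δ)) := by field_simp
    rw [heq, abs_mul, abs_of_pos (mul_pos pT p0)]
    gcongr
  have hcont : ContinuousWithinAt (fun δ : ℝ =>
      T * (√(a T + δ) * √(a 0 + δ)) - |√(a 0 + δ) - √(a T + δ)|) (Set.Ioi 0) 0 := by
    apply Continuous.continuousWithinAt; fun_prop
  have := ge_of_tendsto hcont.tendsto
    (eventually_mem_nhdsWithin.mono fun δ h => sub_nonneg.2 (hδ δ h))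
  simpa using this

namespace IsSelfConcordant

variable {n : ℕ} {f : Vec n → EReal} {x v : Vec n} {t : ℝ}

lemma add_smul_mem_dom (hf : IsSelfConcordant 2 f) (hx : x ∈ dom f) (hxv : x + v ∈ dom f)
    (ht : t ∈ Set.Icc (0 : ℝ) 1) : x + t • v ∈ dom f := by
  have := hf.closedConvex.convexOn.1 hx hxv (sub_nonneg.2 ht.2) ht.1 (sub_add_cancel 1 t)
  convert this using 1
  rw [smul_add, ← add_assoc, ← add_smul]; simp

lemma abs_localNorm_sub_le (hf : IsSelfConcordant 2 f) (hx : x ∈ dom f) (hxv : x + v ∈ dom f)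
    (ht : t ∈ Set.Icc (0 : ℝ) 1) :
    |localNorm f x v - localNorm f (x + t • v) v| ≤
      t * (localNorm f (x + t • v) v * localNorm f x v) := by
  have hm : ∀ τ ∈ Set.Icc 0 t, x + τ • v ∈ dom f := fun τ hτ =>
    hf.add_smul_mem_dom hx hxv ⟨hτ.1, hτ.2.trans ht.2⟩
  have := abs_sqrt_sub_sqrt_le ht.1 (fun τ hτ => hf.hasDerivAt_secondDeriv (hm τ hτ) v v)
    (fun τ hτ => hf.secondDeriv_nonneg (hm τ hτ) v)
    (fun τ hτ => hf.abs_thirdDeriv_le (hm τ hτ) v v)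
  rw [hf.localNorm_eq hx, hf.localNorm_eq (hm t ⟨ht.1, le_rfl⟩)]
  simpa using this

lemma localNorm_nonneg (x v : Vec n) : 0 ≤ localNorm f x v := Real.sqrt_nonneg _

lemma localNorm_mul_le (hf : IsSelfConcordant 2 f) (hx : x ∈ dom f) (hxv : x + v ∈ dom f)
    (ht : t ∈ Set.Icc (0 : ℝ) 1) :
    localNorm f (x + t • v) v * (1 - t * localNorm f x v) ≤ localNorm f x v := by
  have := (abs_le.1 (hf.abs_localNorm_sub_le hx hxv ht)).1
  nlinarith

lemma localNorm_le_mul (hf : IsSelfConcordant 2 f) (hx : x ∈ dom f) (hxv : x + v ∈ dom f)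
    (ht : t ∈ Set.Icc (0 : ℝ) 1) :
    localNorm f x v ≤ localNorm f (x + t • v) v * (1 + t * localNorm f x v) := by
  have := (abs_le.1 (hf.abs_localNorm_sub_le hx hxv ht)).2
  nlinarith

lemma sq_localNorm (hf : IsSelfConcordant 2 f) (hx : x ∈ dom f) (v : Vec n) :
    localNorm f x v ^ 2 = secondDeriv f x v v := by
  rw [hf.localNorm_eq hx, Real.sq_sqrt (hf.secondDeriv_nonneg hx v)]

lemma one_sub_mul_pos (ht : t ∈ Set.Icc (0 : ℝ) 1) {r : ℝ} (h0 : 0 ≤ r) (hr : r < 1) :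
    0 < 1 - t * r := by nlinarith [ht.1, ht.2]

/-- Upper comparison of the Hessians along a segment inside the Dikin ellipsoid. -/
lemma secondDeriv_mul_le (hf : IsSelfConcordant 2 f) (hx : x ∈ dom f) (hxv : x + v ∈ dom f)
    (hr : localNorm f x v < 1) (ht : t ∈ Set.Icc (0 : ℝ) 1) (u : Vec n) :
    secondDeriv f (x + t • v) u u * (1 - t * localNorm f x v) ^ 2 ≤ secondDeriv f x u u := by
  set r := localNorm f x v with hrdef
  have hr0 : 0 ≤ r := localNorm_nonneg x v
  have hsub : ∀ τ ∈ Set.Icc 0 t, τ ∈ Set.Icc (0 : ℝ) 1 := fun τ hτ => ⟨hτ.1, hτ.2.trans ht.2⟩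
  have hm : ∀ τ ∈ Set.Icc 0 t, x + τ • v ∈ dom f := fun τ hτ =>
    hf.add_smul_mem_dom hx hxv (hsub τ hτ)
  -- Since ‖v‖ at x + τv is at most r/(1 - τr), the logarithmic derivative of D²f[u,u] is at most
  -- 2r/(1 - τr), which the factor (1 - τr)² cancels.
  have := le_of_hasDerivAt_nonneg (h := fun τ => -(secondDeriv f (x + τ • v) u u * (1 - τ * r) ^ 2))
    ht.1 (fun τ hτ => ((hf.hasDerivAt_secondDeriv (hm τ hτ) u u).mul
      ((((hasDerivAt_id τ).mul_const r).const_sub 1).pow 2)).neg) (fun τ hτ => by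
      have h1 := (abs_le.1 (hf.abs_thirdDeriv_le (hm τ hτ) v u)).2
      rw [← hf.localNorm_eq (hm τ hτ)] at h1
      have h2 := hf.localNorm_mul_le hx hxv (hsub τ hτ)
      rw [← hrdef] at h2
      have h3 := hf.secondDeriv_nonneg (hm τ hτ) u
      have h4 := one_sub_mul_pos (hsub τ hτ) hr0 hr
      simp only [id, Nat.cast_ofNat, Nat.add_one_sub_one, pow_one, one_mul, Pi.pow_apply]
      have h5 := mul_le_mul_of_nonneg_right h1 (sq_nonneg (1 - τ * r))
      have h6 := mul_le_mul_of_nonneg_left h2 (mul_nonneg h3 h4.le)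
      nlinarith)
  simp only [zero_smul, add_zero, zero_mul, sub_zero, one_pow, mul_one] at this
  linarith

/-- Lower comparison of the Hessians along a segment inside the Dikin ellipsoid. -/
lemma mul_secondDeriv_le (hf : IsSelfConcordant 2 f) (hx : x ∈ dom f) (hxv : x + v ∈ dom f)
    (hr : localNorm f x v < 1) (ht : t ∈ Set.Icc (0 : ℝ) 1) (u : Vec n) :
    (1 - t * localNorm f x v) ^ 2 * secondDeriv f x u u ≤ secondDeriv f (x + t • v) u u := by
  set r := localNorm f x v with hrdef
  have hr0 : 0 ≤ r := localNorm_nonneg x v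
  have hsub : ∀ τ ∈ Set.Icc 0 t, τ ∈ Set.Icc (0 : ℝ) 1 := fun τ hτ => ⟨hτ.1, hτ.2.trans ht.2⟩
  have hm : ∀ τ ∈ Set.Icc 0 t, x + τ • v ∈ dom f := fun τ hτ =>
    hf.add_smul_mem_dom hx hxv (hsub τ hτ)
  have := le_of_hasDerivAt_nonneg (h := fun τ => secondDeriv f (x + τ • v) u u / (1 - τ * r) ^ 2)
    ht.1 (fun τ hτ => (hf.hasDerivAt_secondDeriv (hm τ hτ) u u).div
      ((((hasDerivAt_id τ).mul_const r).const_sub 1).pow 2)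
      (pow_ne_zero 2 (one_sub_mul_pos (hsub τ hτ) hr0 hr).ne')) (fun τ hτ => by
      have h1 := (abs_le.1 (hf.abs_thirdDeriv_le (hm τ hτ) v u)).1
      rw [← hf.localNorm_eq (hm τ hτ)] at h1
      have h2 := hf.localNorm_mul_le hx hxv (hsub τ hτ)
      rw [← hrdef] at h2
      have h3 := hf.secondDeriv_nonneg (hm τ hτ) u
      have h4 := one_sub_mul_pos (hsub τ hτ) hr0 hr
      apply div_nonneg _ (by positivity)
      simp only [id, Nat.cast_ofNat, Nat.add_one_sub_one, pow_one, one_mul, Pi.pow_apply]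
      have h5 := mul_le_mul_of_nonneg_right h1 (sq_nonneg (1 - τ * r))
      have h6 := mul_le_mul_of_nonneg_left h2 (mul_nonneg h3 h4.le)
      nlinarith)
  simp only [zero_smul, add_zero, zero_mul, sub_zero, one_pow, div_one] at this
  rw [le_div_iff₀ (pow_pos (one_sub_mul_pos ht hr0 hr) 2)] at this
  linarith

lemma hasDerivAt_div_one_sub {r : ℝ} (c : ℝ) (h : 0 < 1 - t * r) :
    HasDerivAt (fun τ : ℝ => τ * c / (1 - τ * r)) (c / (1 - t * r) ^ 2) t := by
  have := ((hasDerivAt_id t).mul_const c).div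
    (((hasDerivAt_id t).mul_const r).const_sub 1) h.ne'
  refine this.congr_deriv ?_
  simp only [id]
  congr 1
  ring

lemma hasDerivAt_div_one_add {r : ℝ} (h : 0 < 1 + t * r) :
    HasDerivAt (fun τ : ℝ => τ * r ^ 2 / (1 + τ * r)) (r ^ 2 / (1 + t * r) ^ 2) t := by
  have := ((hasDerivAt_id t).mul_const (r ^ 2)).div
    (((hasDerivAt_id t).mul_const r).const_add 1) h.ne'
  refine this.congr_deriv ?_
  simp only [id]
  congr 1
  ring

lemma fderiv_sub_le (hf : IsSelfConcordant 2 f) (hx : x ∈ dom f) (hxv : x + v ∈ dom f)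
    (hr : localNorm f x v < 1) (ht : t ∈ Set.Icc (0 : ℝ) 1) :
    fderiv ℝ (finiteValue f) (x + t • v) v - fderiv ℝ (finiteValue f) x v ≤
      t * localNorm f x v ^ 2 / (1 - t * localNorm f x v) := by
  set r := localNorm f x v with hrdef
  have hr0 : 0 ≤ r := localNorm_nonneg x v
  have hsub : ∀ τ ∈ Set.Icc 0 t, τ ∈ Set.Icc (0 : ℝ) 1 := fun τ hτ => ⟨hτ.1, hτ.2.trans ht.2⟩
  have hm : ∀ τ ∈ Set.Icc 0 t, x + τ • v ∈ dom f := fun τ hτ =>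
    hf.add_smul_mem_dom hx hxv (hsub τ hτ)
  have := le_of_hasDerivAt_nonneg
    (h := fun τ => τ * r ^ 2 / (1 - τ * r) - fderiv ℝ (finiteValue f) (x + τ • v) v)
    ht.1 (fun τ hτ => (hasDerivAt_div_one_sub (r ^ 2) (one_sub_mul_pos (hsub τ hτ) hr0 hr)).sub
      (hf.hasDerivAt_fderiv (hm τ hτ) v)) (fun τ hτ => by
      have h4 := one_sub_mul_pos (hsub τ hτ) hr0 hr
      have h2 := hf.secondDeriv_mul_le hx hxv hr (hsub τ hτ) v
      rw [← hf.sq_localNorm hx, ← hrdef] at h2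
      rw [sub_nonneg, le_div_iff₀ (by positivity)]
      exact h2)
  simp only [zero_smul, add_zero, zero_mul, zero_div, zero_sub] at this
  linarith

/-- The gradient of a self-concordant function is strongly monotone in the local sense. -/
lemma le_fderiv_sub (hf : IsSelfConcordant 2 f) (hx : x ∈ dom f) (hxv : x + v ∈ dom f) :
    localNorm f x v ^ 2 / (1 + localNorm f x v) ≤
      fderiv ℝ (finiteValue f) (x + v) v - fderiv ℝ (finiteValue f) x v := by
  set r := localNorm f x v with hrdef
  have hr0 : 0 ≤ r := localNorm_nonneg x v
  have hm : ∀ τ ∈ Set.Icc (0 : ℝ) 1, x + τ • v ∈ dom f := fun τ hτ =>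
    hf.add_smul_mem_dom hx hxv hτ
  -- The lower bound r/(1 + τr) for ‖v‖ at x + τv holds for every r, so no smallness is needed.
  have := le_of_hasDerivAt_nonneg
    (h := fun τ => fderiv ℝ (finiteValue f) (x + τ • v) v - τ * r ^ 2 / (1 + τ * r))
    zero_le_one (fun τ hτ => (hf.hasDerivAt_fderiv (hm τ hτ) v).sub
      (hasDerivAt_div_one_add (r := r) (by nlinarith [hτ.1]))) (fun τ hτ => by
      have h2 := hf.localNorm_le_mul hx hxv hτ
      rw [← hrdef] at h2
      have h3 : 0 < 1 + τ * r := by nlinarith [hτ.1]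
      rw [sub_nonneg, div_le_iff₀ (by positivity), ← hf.sq_localNorm (hm τ hτ), ← mul_pow]
      gcongr)
  simp only [zero_smul, add_zero, zero_mul, zero_div, sub_zero, one_smul, one_mul] at this
  linarith

/-- The upper bound on a self-concordant function by its linearization. -/
lemma finiteValue_add_le (hf : IsSelfConcordant 2 f) (hx : x ∈ dom f) (hxv : x + v ∈ dom f)
    (hr : localNorm f x v < 1) :
    finiteValue f (x + v) ≤ finiteValue f x + fderiv ℝ (finiteValue f) x v +
      (-localNorm f x v - Real.log (1 - localNorm f x v)) := by
  set r := localNorm f x v with hrdef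
  have hr0 : 0 ≤ r := localNorm_nonneg x v
  have hm : ∀ τ ∈ Set.Icc (0 : ℝ) 1, x + τ • v ∈ dom f := fun τ hτ =>
    hf.add_smul_mem_dom hx hxv hτ
  have := le_of_hasDerivAt_nonneg
    (h := fun τ => τ * fderiv ℝ (finiteValue f) x v + (-(τ * r) - Real.log (1 - τ * r)) -
      finiteValue f (x + τ • v))
    zero_le_one (fun τ hτ => (((hasDerivAt_id τ).mul_const _).add
      (((hasDerivAt_id τ).mul_const r).neg.sub ((((hasDerivAt_id τ).mul_const r).const_sub 1).log
        (one_sub_mul_pos hτ hr0 hr).ne'))).sub (hf.hasDerivAt_value (hm τ hτ))) (fun τ hτ => by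
      have h4 := one_sub_mul_pos hτ hr0 hr
      have h2 := hf.fderiv_sub_le hx hxv hr hτ
      rw [← hrdef] at h2
      simp only [id, one_mul]
      have h3 : -r - -r / (1 - τ * r) = τ * r ^ 2 / (1 - τ * r) := by
        rw [eq_div_iff h4.ne', sub_mul, div_mul_cancel₀ _ h4.ne']
        ring
      linarith)
  simp only [zero_smul, add_zero, zero_mul, sub_zero, one_smul, one_mul, neg_zero,
    Real.log_one] at this
  linarith

lemma localNorm_smul (hf : IsSelfConcordant 2 f) (hx : x ∈ dom f) (ht : 0 ≤ t) (v : Vec n) :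
    localNorm f x (t • v) = t * localNorm f x v := by
  rw [hf.localNorm_eq hx, hf.localNorm_eq hx]
  simp only [map_smul, smul_apply, smul_eq_mul, ← mul_assoc]
  rw [Real.sqrt_mul (by positivity), ← sq, Real.sqrt_sq ht]

/-- The open unit Dikin ellipsoid is contained in the domain. -/
lemma add_mem_dom (hf : IsSelfConcordant 2 f) (hx : x ∈ dom f) (hr : localNorm f x v < 1) :
    x + v ∈ dom f := by
  set r := localNorm f x v with hrdef
  have hr0 : 0 ≤ r := localNorm_nonneg x v
  -- C bounds f at every point of the segment that lies in the domain. Hence the good parameters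
  -- form a closed set, by lower semicontinuity, that is open to the right, as the domain is open:
  -- all of [0, 1].
  set C := finiteValue f x + |fderiv ℝ (finiteValue f) x v| - Real.log (1 - r)
  set S := {t : ℝ | f (x + t • v) ≤ C}
  have hS : ∀ t ∈ Set.Icc (0 : ℝ) 1, x + t • v ∈ dom f → t ∈ S := by
    intro t ht hxt
    have hn : localNorm f x (t • v) = t * r := hf.localNorm_smul hx ht.1 v
    have h4 := one_sub_mul_pos ht hr0 hr
    have := hf.finiteValue_add_le hx hxt (by rw [hn]; linarith)
    rw [hn, map_smul, smul_eq_mul] at this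
    change f _ ≤ _
    rw [← hf.closedConvex.coe_finiteValue hxt]
    have hl : Real.log (1 - r) ≤ Real.log (1 - t * r) :=
      Real.log_le_log (by linarith) (by nlinarith [ht.2])
    have ha : t * fderiv ℝ (finiteValue f) x v ≤ |fderiv ℝ (finiteValue f) x v| := by
      have := le_abs_self (fderiv ℝ (finiteValue f) x v)
      have := abs_nonneg (fderiv ℝ (finiteValue f) x v)
      nlinarith [ht.1, ht.2]
    have h0 := mul_nonneg ht.1 hr0
    exact EReal.coe_le_coe_iff.2 (by simp only [C]; linarith)
  have hclosed : IsClosed (S ∩ Set.Icc 0 1) := by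
    refine IsClosed.inter ?_ isClosed_Icc
    exact (hf.closedConvex.lsc.isClosed_preimage (C : EReal)).preimage
      (f := fun t : ℝ => x + t • v) (by fun_prop)
  have hdom : ∀ t ∈ S, x + t • v ∈ dom f := fun t ht => lt_of_le_of_lt ht (EReal.coe_lt_top _)
  have := hclosed.Icc_subset_of_forall_mem_nhdsWithin
    (hS 0 (by simp) (by simpa using hx)) (fun t ht => by
      have hev := (hf.isOpen_line x v).mem_nhds (hdom t ht.1)
      filter_upwards [mem_nhdsWithin_of_mem_nhds hev, self_mem_nhdsWithin,
        mem_nhdsWithin_of_mem_nhds (Iio_mem_nhds ht.2.2)] with τ h1 h2 h3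
      exact hS τ ⟨ht.2.1.trans (le_of_lt h2), le_of_lt h3⟩ h1)
  simpa using hdom 1 (this (by simp))

/-- The error of the linearization of the gradient. -/
lemma fderiv_sub_sub_secondDeriv_le (hf : IsSelfConcordant 2 f) (hx : x ∈ dom f)
    (hr : localNorm f x v < 1) (u : Vec n) :
    fderiv ℝ (finiteValue f) (x + v) u - fderiv ℝ (finiteValue f) x u - secondDeriv f x v u ≤
      localNorm f x u * (localNorm f x v ^ 2 / (1 - localNorm f x v)) := by
  have hxv := hf.add_mem_dom hx hr
  set r := localNorm f x v with hrdef
  set k := localNorm f x u with hkdef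
  have hr0 : 0 ≤ r := localNorm_nonneg x v
  have hk0 : 0 ≤ k := localNorm_nonneg x u
  have hm : ∀ τ ∈ Set.Icc (0 : ℝ) 1, x + τ • v ∈ dom f := fun τ hτ =>
    hf.add_smul_mem_dom hx hxv hτ
  have hH : ∀ τ ∈ Set.Icc (0 : ℝ) 1, (secondDeriv f (x + τ • v) - secondDeriv f x) v u ≤
      (1 / (1 - τ * r) ^ 2 - 1) * (r * k) := by
    intro τ hτ
    have h4 := one_sub_mul_pos hτ hr0 hr
    have h5 : (1 - τ * r) ^ 2 ≤ 1 := by nlinarith [mul_nonneg hτ.1 hr0]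
    have h6 : 1 ≤ 1 / (1 - τ * r) ^ 2 := by rw [le_div_iff₀ (by positivity)]; linarith
    have := abs_apply_le_of_abs_apply_self_le (secondDeriv f x)
      (secondDeriv f (x + τ • v) - secondDeriv f x) (hf.secondDeriv_symm hx)
      (fun a b => by simp [hf.secondDeriv_symm hx a b, hf.secondDeriv_symm (hm τ hτ) a b])
      (hf.secondDeriv_nonneg hx) (sub_nonneg.2 h6) (fun w => by
        have g1 := hf.secondDeriv_mul_le hx hxv hr hτ w
        have g2 := hf.mul_secondDeriv_le hx hxv hr hτ w
        have g3 := hf.secondDeriv_nonneg hx w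
        rw [← hrdef] at g1 g2
        have g4 : secondDeriv f (x + τ • v) w w ≤ 1 / (1 - τ * r) ^ 2 * secondDeriv f x w w := by
          rw [one_div_mul_eq_div, le_div_iff₀ (by positivity)]; exact g1
        -- The lower comparison is the better one, because y + 1/y ≥ 2; a single constant thus
        -- serves both signs.
        have g5 : 1 - (1 - τ * r) ^ 2 ≤ 1 / (1 - τ * r) ^ 2 - 1 := by
          have hp : 0 < (1 - τ * r) ^ 2 := by positivity
          generalize (1 - τ * r) ^ 2 = y at hp
          have : 1 / y - 1 - (1 - y) = (1 - y) ^ 2 / y := by field_simp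
          have h0 : 0 ≤ (1 - y) ^ 2 / y := by positivity
          linarith
        have g6 := mul_le_mul_of_nonneg_right g5 g3
        simp only [_root_.sub_apply]
        rw [abs_le]
        constructor <;> nlinarith) v u
    rw [← hf.localNorm_eq hx, ← hf.localNorm_eq hx] at this
    exact (le_abs_self _).trans this
  have := le_of_hasDerivAt_nonneg
    (h := fun τ => τ * (r * k) / (1 - τ * r) - τ * (r * k) -
      (fderiv ℝ (finiteValue f) (x + τ • v) u - τ * secondDeriv f x v u))
    zero_le_one (fun τ hτ => ((hasDerivAt_div_one_sub (r * k) (one_sub_mul_pos hτ hr0 hr)).sub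
      ((hasDerivAt_id τ).mul_const _)).sub
      ((hf.hasDerivAt_fderiv (hm τ hτ) u).sub ((hasDerivAt_id τ).mul_const _))) (fun τ hτ => by
      have h1 := hH τ hτ
      simp only [_root_.sub_apply] at h1
      rw [sub_mul, one_div_mul_eq_div] at h1
      linarith)
  simp only [zero_smul, add_zero, zero_mul, sub_zero, one_smul, one_mul, zero_div] at this
  have h1 : k * (r ^ 2 / (1 - r)) = r * k / (1 - r) - r * k := by
    have : 1 - r ≠ 0 := by linarith
    field_simp
    ring
  linarith

end IsSelfConcordant

end Estimates

/-! ### Optimality conditions and single steps. -/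

section Steps

/-- The first-order optimality condition for the sum of a convex function and a differentiable
one. -/
lemma _root_.ConvexOn.sub_fderiv_le_of_isLocalMin_add {E : Type*} [NormedAddCommGroup E]
    [NormedSpace ℝ E] {G : Set E} {γ q : E → ℝ} {q' : E →L[ℝ] ℝ} {s y : E}
    (hγ : ConvexOn ℝ G γ) (hq : HasFDerivAt q q' s) (hs : s ∈ G)
    (hmin : ∀ᶠ z in nhds s, z ∈ G → q s + γ s ≤ q z + γ z) (hy : y ∈ G) :
    γ s - q' (y - s) ≤ γ y := by
  -- γ need not be differentiable, so on the segment it is replaced by its chord, which lies above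
  -- it and agrees with it at s.
  have hd : HasDerivAt (fun t : ℝ => q (s + t • (y - s)) + t * (γ y - γ s))
      (q' (y - s) + 1 * (γ y - γ s)) 0 :=
    (HasFDerivAt.hasDerivAt_comp_line (by simpa using hq)).add ((hasDerivAt_id _).mul_const _)
  have hcont : Filter.Tendsto (fun t : ℝ => s + t • (y - s)) (nhds 0) (nhds s) := by
    have : Continuous fun t : ℝ => s + t • (y - s) := by fun_prop
    simpa using this.tendsto 0
  have hev : ∀ᶠ t : ℝ in nhdsWithin 0 (Set.Ioi 0), 0 ≤ t⁻¹ • ((q (s + (0 + t) • (y - s)) +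
      (0 + t) * (γ y - γ s)) - (q (s + (0 : ℝ) • (y - s)) + 0 * (γ y - γ s))) := by
    filter_upwards [mem_nhdsWithin_of_mem_nhds (hcont.eventually hmin), self_mem_nhdsWithin,
      mem_nhdsWithin_of_mem_nhds (Iio_mem_nhds one_pos)] with t h1 h2 h3
    have h2 : 0 < t := h2
    have h3 : t < 1 := h3
    have heq : s + t • (y - s) = (1 - t) • s + t • y := by module
    have hmem := hγ.1 hs hy (sub_nonneg.2 h3.le) h2.le (sub_add_cancel 1 t)
    have hle := hγ.2 hs hy (sub_nonneg.2 h3.le) h2.le (sub_add_cancel 1 t)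
    rw [← heq] at hmem hle
    have := h1 hmem
    simp only [smul_eq_mul] at hle
    rw [smul_eq_mul]
    refine mul_nonneg (by positivity) ?_
    simp only [zero_add, zero_smul, add_zero, zero_mul]
    linarith
  have := ge_of_tendsto hd.tendsto_slope_zero_right hev
  linarith

variable {n : ℕ} {f g : Vec n → EReal} {x s xs : Vec n}

lemma mem_dom_objective (hf : IsProperClosedConvex f) (hg : IsProperClosedConvex g) :
    x ∈ dom (objective f g) ↔ x ∈ dom f ∧ x ∈ dom g := by
  simp only [dom, objective, Set.mem_ofPred_eq, lt_top_iff_ne_top]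
  exact EReal.add_ne_top_iff_ne_top₂ (hf.ne_bot x) (hg.ne_bot x)

lemma coe_objective (hf : IsProperClosedConvex f) (hg : IsProperClosedConvex g)
    (hxf : x ∈ dom f) (hxg : x ∈ dom g) :
    objective f g x = ((finiteValue f x + finiteValue g x : ℝ) : EReal) := by
  rw [EReal.coe_add, hf.coe_finiteValue hxf, hg.coe_finiteValue hxg, objective]

lemma toReal_objective (hf : IsProperClosedConvex f) (hg : IsProperClosedConvex g)
    (hxf : x ∈ dom f) (hxg : x ∈ dom g) :
    (objective f g x).toReal = finiteValue f x + finiteValue g x := by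
  rw [coe_objective hf hg hxf hxg, EReal.toReal_coe]

/-- The optimality condition at a minimizer of the composite objective. -/
lemma sub_fderiv_le_of_isMinimizer (hf : IsSelfConcordant 2 f) (hg : IsProperClosedConvex g)
    (hmin : ∀ y, objective f g xs ≤ objective f g y) (hxf : xs ∈ dom f) (hxg : xs ∈ dom g)
    {y : Vec n} (hy : y ∈ dom g) :
    finiteValue g xs - fderiv ℝ (finiteValue f) xs (y - xs) ≤ finiteValue g y := by
  refine hg.convexOn.sub_fderiv_le_of_isLocalMin_add
    ((hf.contDiffAt hxf).differentiableAt (by norm_num)).hasFDerivAt hxg ?_ hy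
  filter_upwards [hf.isOpen_dom.mem_nhds hxf] with z hz hzg
  have := hmin z
  rw [coe_objective hf.closedConvex hg hxf hxg, coe_objective hf.closedConvex hg hz hzg] at this
  exact_mod_cast this

lemma mem_dom_of_mem_newtonSet (hg : IsProperClosedConvex g) (hs : s ∈ newtonSet f g x) :
    s ∈ dom g := by
  obtain ⟨z, hz⟩ := hg.dom_nonempty
  have := hs z
  rw [← hg.coe_finiteValue hz, ← EReal.coe_add] at this
  by_contra hns
  have htop : g s = ⊤ := not_lt_top_iff.1 hns
  rw [htop, EReal.top_add_coe] at this
  exact absurd this (not_le.2 (EReal.coe_lt_top _))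

/-- The optimality condition of the proximal-Newton subproblem. -/
lemma sub_le_of_mem_newtonSet (hf : IsSelfConcordant 2 f) (hg : IsProperClosedConvex g)
    (hx : x ∈ dom f) (hs : s ∈ newtonSet f g x) {y : Vec n} (hy : y ∈ dom g) :
    finiteValue g s - (fderiv ℝ (finiteValue f) x (y - s) + secondDeriv f x (s - x) (y - s)) ≤
      finiteValue g y := by
  have hsg := mem_dom_of_mem_newtonSet hg hs
  have hq : HasFDerivAt (fun z : Vec n => (1 / 2 : ℝ) * inner ℝ z (hess f x z) -
      inner ℝ (hess f x x - grad f x) z) (secondDeriv f x (s - x) + fderiv ℝ (finiteValue f) x)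
      s := by
    have h1 := (((hasFDerivAt_id s).inner ℝ (hess f x).hasFDerivAt).const_mul (1 / 2 : ℝ)).sub
      ((innerSL ℝ (hess f x x - grad f x)).hasFDerivAt (x := s))
    refine h1.congr_fderiv ?_
    ext w
    simp [inner_grad]
    rw [real_inner_comm w (hess f x x), hf.inner_hess hx, hf.inner_hess hx, hf.inner_hess hx,
      hf.secondDeriv_symm hx w s]
    ring
  have := hg.convexOn.sub_fderiv_le_of_isLocalMin_add hq hsg
    (Filter.Eventually.of_forall fun z hz => by
      have := hs z
      rw [← hg.coe_finiteValue hsg, ← hg.coe_finiteValue hz, ← EReal.coe_add, ← EReal.coe_add,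
        EReal.coe_le_coe_iff] at this
      linarith) hy
  simpa [add_comm] using this

namespace IsSelfConcordant

lemma one_sub_mul_localNorm_le (hf : IsSelfConcordant 2 f) {v : Vec n} (hx : x ∈ dom f)
    (hr : localNorm f x v < 1) (u : Vec n) :
    (1 - localNorm f x v) * localNorm f x u ≤ localNorm f (x + v) u := by
  have hxv := hf.add_mem_dom hx hr
  have := hf.mul_secondDeriv_le hx hxv hr (t := 1) (by simp) u
  rw [one_smul, one_mul, ← hf.sq_localNorm hx, ← hf.sq_localNorm hxv, ← mul_pow] at this
  exact le_of_sq_le_sq this (localNorm_nonneg _ _)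

lemma localNorm_add_mul_le (hf : IsSelfConcordant 2 f) {v : Vec n} (hx : x ∈ dom f)
    (hr : localNorm f x v < 1) (u : Vec n) :
    localNorm f (x + v) u * (1 - localNorm f x v) ≤ localNorm f x u := by
  have hxv := hf.add_mem_dom hx hr
  have := hf.secondDeriv_mul_le hx hxv hr (t := 1) (by simp) u
  rw [one_smul, one_mul, ← hf.sq_localNorm hx, ← hf.sq_localNorm hxv, ← mul_pow] at this
  exact le_of_sq_le_sq this (localNorm_nonneg _ _)

lemma localNorm_neg (v : Vec n) : localNorm f x (-v) = localNorm f x v := by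
  simp [localNorm]

lemma secondDeriv_le (hf : IsSelfConcordant 2 f) (hx : x ∈ dom f) (u v : Vec n) :
    secondDeriv f x u v ≤ localNorm f x u * localNorm f x v := by
  have := abs_apply_le_of_abs_apply_self_le (secondDeriv f x) (secondDeriv f x)
    (hf.secondDeriv_symm hx) (hf.secondDeriv_symm hx) (hf.secondDeriv_nonneg hx) zero_le_one
    (fun u => by rw [abs_of_nonneg (hf.secondDeriv_nonneg hx u), one_mul]) u v
  rw [one_mul, ← hf.localNorm_eq hx, ← hf.localNorm_eq hx] at this
  exact (le_abs_self _).trans this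

lemma localNorm_add_le (hf : IsSelfConcordant 2 f) (hx : x ∈ dom f) (u v : Vec n) :
    localNorm f x (u + v) ≤ localNorm f x u + localNorm f x v := by
  refine le_of_sq_le_sq ?_ (add_nonneg (localNorm_nonneg _ _) (localNorm_nonneg _ _))
  have h := hf.secondDeriv_le hx u v
  rw [hf.sq_localNorm hx, add_sq, hf.sq_localNorm hx, hf.sq_localNorm hx]
  simp only [map_add, _root_.add_apply, hf.secondDeriv_symm hx v u]
  linarith

end IsSelfConcordant

open IsSelfConcordant

/-- A damped proximal-Newton step decreases the objective by `λ - ln (1 + λ)`. -/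
lemma damped_step (hf : IsSelfConcordant 2 f) (hg : IsProperClosedConvex g)
    (hx : x ∈ dom (objective f g)) (hs : s ∈ newtonSet f g x) {l : ℝ}
    (hl : localNorm f x (s - x) = l) :
    x + (1 + l)⁻¹ • (s - x) ∈ dom (objective f g) ∧
      (objective f g (x + (1 + l)⁻¹ • (s - x))).toReal ≤
        (objective f g x).toReal - (l - Real.log (1 + l)) := by
  obtain ⟨hxf, hxg⟩ := (mem_dom_objective hf.closedConvex hg).1 hx
  have hsg := mem_dom_of_mem_newtonSet hg hs
  have hl0 : 0 ≤ l := hl ▸ localNorm_nonneg _ _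
  have h1l : 0 < 1 + l := by linarith
  -- This a minimizes the upper bound -a l² - a l - ln(1 - a l) on the change of F; it gives 1 - a l
  -- = a.
  set a := (1 + l)⁻¹ with ha
  have ha0 : 0 < a := by positivity
  have hal : a * (1 + l) = 1 := inv_mul_cancel₀ h1l.ne'
  have ha1 : a ≤ 1 := by nlinarith
  have hn : localNorm f x (a • (s - x)) = a * l := by rw [hf.localNorm_smul hxf ha0.le, hl]
  have hlt : localNorm f x (a • (s - x)) < 1 := by rw [hn]; linarith
  have hpf := hf.add_mem_dom hxf hlt
  have heq : x + a • (s - x) = (1 - a) • x + a • s := by module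
  have hpg : x + a • (s - x) ∈ dom g := by
    rw [heq]; exact hg.convexOn.1 hxg hsg (by linarith) ha0.le (by ring)
  refine ⟨(mem_dom_objective hf.closedConvex hg).2 ⟨hpf, hpg⟩, ?_⟩
  rw [toReal_objective hf.closedConvex hg hpf hpg, toReal_objective hf.closedConvex hg hxf hxg]
  have h1 := hf.finiteValue_add_le hxf hpf hlt
  rw [hn, map_smul, smul_eq_mul, show 1 - a * l = a by linarith, ha, Real.log_inv, ← ha] at h1
  have h2 := hg.convexOn.2 hxg hsg (by linarith : 0 ≤ 1 - a) ha0.le (by ring)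
  rw [← heq, smul_eq_mul, smul_eq_mul] at h2
  have h3 := sub_le_of_mem_newtonSet hf hg hxf hs hxg
  rw [← neg_sub s x, map_neg, map_neg, ← hf.sq_localNorm hxf, hl] at h3
  have h4 := mul_le_mul_of_nonneg_left h3 ha0.le
  nlinarith

lemma full_step_mem_dom (hf : IsSelfConcordant 2 f) (hg : IsProperClosedConvex g)
    (hx : x ∈ dom (objective f g)) (hs : s ∈ newtonSet f g x)
    (hl : localNorm f x (s - x) < 1) : s ∈ dom (objective f g) := by
  refine (mem_dom_objective hf.closedConvex hg).2 ⟨?_, mem_dom_of_mem_newtonSet hg hs⟩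
  simpa using hf.add_mem_dom ((mem_dom_objective hf.closedConvex hg).1 hx).1 hl

/-- The decrements of full proximal-Newton steps converge quadratically. -/
lemma full_step_decrement_le (hf : IsSelfConcordant 2 f) (hg : IsProperClosedConvex g)
    (hx : x ∈ dom f) (hs : s ∈ newtonSet f g x) {s' : Vec n} (hs' : s' ∈ newtonSet f g s) {l : ℝ}
    (hl : localNorm f x (s - x) = l) (hl1 : l < 1) :
    localNorm f s (s' - s) ≤ (l / (1 - l)) ^ 2 := by
  subst hl
  set l := localNorm f x (s - x)
  have hsf : s ∈ dom f := by simpa using hf.add_mem_dom hx hl1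
  -- Each solution is tested in the other's optimality condition. The sum bounds m² by the error of
  -- linearizing the gradient at x, in direction s - s'.
  have h1 := sub_le_of_mem_newtonSet hf hg hx hs (mem_dom_of_mem_newtonSet hg hs')
  have h2 := sub_le_of_mem_newtonSet hf hg hsf hs' (mem_dom_of_mem_newtonSet hg hs)
  have h3 := hf.fderiv_sub_sub_secondDeriv_le hx hl1 (s - s')
  have h4 := hf.one_sub_mul_localNorm_le hx hl1 (s' - s)
  rw [add_sub_cancel, ← neg_sub s' s, localNorm_neg] at h3
  rw [add_sub_cancel] at h4
  rw [← neg_sub s' s] at h2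
  simp only [map_neg, ← hf.sq_localNorm hsf] at h2 h3
  set m := localNorm f s (s' - s)
  set k := localNorm f x (s' - s)
  change _ ≤ k * (l ^ 2 / (1 - l)) at h3
  change (1 - l) * k ≤ m at h4
  have hm : 0 ≤ m := localNorm_nonneg _ _
  have hp : 0 < 1 - l := by linarith
  have h5 : m ^ 2 ≤ k * (l ^ 2 / (1 - l)) := by linarith
  have h6 : k * (l ^ 2 / (1 - l)) = ((1 - l) * k) * (l / (1 - l)) ^ 2 := by field_simp
  have h7 : m * m ≤ m * (l / (1 - l)) ^ 2 := by
    rw [← sq]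
    exact (h5.trans_eq h6).trans (by gcongr)
  rcases hm.eq_or_lt with h0 | h0
  · rw [← h0]; positivity
  · exact le_of_mul_le_mul_left h7 h0

/-- A small decrement bounds the local distance to the minimizer. -/
lemma localNorm_sub_minimizer_le (hf : IsSelfConcordant 2 f) (hg : IsProperClosedConvex g)
    (hmin : ∀ y, objective f g xs ≤ objective f g y) (hx : x ∈ dom (objective f g))
    (hs : s ∈ newtonSet f g x) {l : ℝ} (hl : localNorm f x (s - x) = l) (hl1 : l ≤ 0.2) :
    localNorm f xs (x - xs) ≤ 2 * l := by
  have hxs : xs ∈ dom (objective f g) := (hmin x).trans_lt hx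
  obtain ⟨hxf, hxg⟩ := (mem_dom_objective hf.closedConvex hg).1 hx
  obtain ⟨hxsf, hxsg⟩ := (mem_dom_objective hf.closedConvex hg).1 hxs
  have hl1' : localNorm f x (s - x) < 1 := by rw [hl]; norm_num at hl1 ⊢; linarith
  have hsf : s ∈ dom f := by simpa using hf.add_mem_dom hxf hl1'
  have hsg := mem_dom_of_mem_newtonSet hg hs
  -- Testing s and xs against each other, with strong monotonicity between them, bounds r²/(1 + r)
  -- by the linearization error at x.
  have h1 := sub_le_of_mem_newtonSet hf hg hxf hs hxsg
  have h2 := sub_fderiv_le_of_isMinimizer hf hg hmin hxsf hxsg hsg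
  have h3 := hf.fderiv_sub_sub_secondDeriv_le hxf hl1' (s - xs)
  have h4 := hf.one_sub_mul_localNorm_le hxf hl1' (xs - s)
  have h5 := hf.le_fderiv_sub hsf (v := xs - s) (by simpa using hxsf)
  have h6 := hf.localNorm_add_mul_le hxf hl1' (s - x)
  have h7 := hf.localNorm_add_le hsf (s - x) (xs - s)
  rw [← neg_sub xs s, localNorm_neg] at h3
  rw [← neg_sub xs s] at h2
  simp only [add_sub_cancel, map_neg, hl] at h2 h3 h4 h5 h6
  rw [sub_add_sub_cancel'] at h7
  set r := localNorm f s (xs - s)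
  set k := localNorm f x (xs - s)
  set p := localNorm f s (s - x)
  have hr0 : 0 ≤ r := localNorm_nonneg _ _
  have hp0 : 0 ≤ p := localNorm_nonneg _ _
  have hl0 : 0 ≤ l := hl ▸ localNorm_nonneg _ _
  have hlp : 0 < 1 - l := by rw [hl] at hl1'; linarith
  -- As l ≤ 0.2, 1/(1 - l) ≤ 1.25. Then 0.3125 = 1.25 · 0.25, and solving `h9` for r gives r ≤ l/3,
  -- rounded up to 0.3334 l.
  have hp : p ≤ 1.25 * l := by norm_num at hl1 ⊢; nlinarith
  have hq : l ^ 2 / (1 - l) ≤ 0.25 * l := by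
    rw [div_le_iff₀ hlp]; norm_num at hl1 ⊢; nlinarith
  have hk : k ≤ 1.25 * r := by
    have hk0 : 0 ≤ k := localNorm_nonneg _ _
    norm_num at hl1 ⊢; nlinarith
  have h8 : r ^ 2 / (1 + r) ≤ r * (0.3125 * l) := by
    have : k * (l ^ 2 / (1 - l)) ≤ (1.25 * r) * (0.25 * l) := by gcongr
    norm_num at this ⊢
    linarith
  rw [div_le_iff₀ (by linarith)] at h8
  have h9 : r ≤ 0.3125 * l * (1 + r) := by
    rcases hr0.eq_or_lt with h0 | h0
    · rw [← h0]; positivity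
    · refine le_of_mul_le_mul_left ?_ h0
      linarith
  have h10 : r ≤ 0.3334 * l := by norm_num at *; nlinarith
  have hr1 : r < 1 := by norm_num at *; linarith
  have h11 := hf.localNorm_add_mul_le hsf (v := xs - s) hr1 (xs - x)
  rw [add_sub_cancel, ← neg_sub x xs, localNorm_neg, localNorm_neg] at h11
  rw [← neg_sub x xs, localNorm_neg] at h7
  set d := localNorm f xs (x - xs)
  have hd0 : 0 ≤ d := localNorm_nonneg _ _
  have h12 : d * (1 - r) ≤ p + r := h11.trans h7
  norm_num at *
  nlinarith

end Steps

/-! ### Numerical constants. -/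

/-- The tangent to ln at 1.2 has slope below 1, so l = 0.2 is the worst case, and 0.017 = 0.2 -
0.183. -/
lemma le_sub_log_one_add_of_lt {l : ℝ} (hl : 0.2 < l) : 0.017 ≤ l - Real.log (1 + l) := by
  have h1 : Real.log 1.2 ≤ 0.183 := by
    rw [Real.log_le_iff_le_exp (by norm_num)]
    refine le_trans ?_ (Real.sum_le_exp_of_nonneg (by norm_num) 4)
    norm_num [Finset.sum_range_succ, Nat.factorial]
  have h2 := Real.log_le_sub_one_of_pos (x := (1 + l) / 1.2) (by norm_num at *; linarith)
  rw [Real.log_div (by norm_num at *; linarith) (by norm_num)] at h2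
  norm_num at *
  linarith

/-- Since 0.3125² e < 0.4375 = 0.28/0.64, the hypothesis forces 0.28/ε ≥ exp(2^m); then 1.5 ln 2 >
1. -/
lemma natCast_le_log_log_of_lt {m : ℕ} {ε : ℝ} (hε : 0 < ε)
    (h : ε < 0.64 * 0.3125 ^ (2 ^ (m + 1))) :
    (m : ℝ) ≤ 1.5 * Real.log (Real.log (0.28 / ε)) := by
  have he : (0.3125 : ℝ) ^ (2 ^ (m + 1)) * Real.exp (2 ^ m) ≤ 0.4375 := by
    have h1 : Real.exp ((2 : ℝ) ^ m) = Real.exp 1 ^ (2 ^ m) := by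
      rw [← Real.exp_nat_mul]; norm_num
    rw [h1, pow_succ, mul_comm (2 ^ m) 2, pow_mul, ← mul_pow]
    have h2 : (0.3125 : ℝ) ^ 2 * Real.exp 1 ≤ 0.4375 := by
      have := Real.exp_one_lt_d9
      norm_num at *
      linarith
    have h3 : 0 ≤ (0.3125 : ℝ) ^ 2 * Real.exp 1 := by positivity
    refine (pow_le_of_le_one h3 (h2.trans (by norm_num)) (by positivity)).trans h2
  have h1 : (2 : ℝ) ^ m ≤ Real.log (0.28 / ε) := by
    rw [Real.le_log_iff_exp_le (by positivity), le_div_iff₀ hε]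
    have := mul_le_mul_of_nonneg_right h.le (Real.exp_nonneg (2 ^ m))
    norm_num at *
    linarith
  have h2 : m * Real.log 2 ≤ Real.log (Real.log (0.28 / ε)) := by
    rw [← Real.log_pow]
    exact Real.log_le_log (by positivity) h1
  have h3 := mul_le_mul_of_nonneg_left Real.log_two_gt_d9.le (Nat.cast_nonneg (α := ℝ) m)
  have h4 := Nat.cast_nonneg (α := ℝ) m
  norm_num at *
  linarith

/-! ### The two phases of a run. -/

section Run

variable {n : ℕ} {f g : Vec n → EReal} {ε : ℝ} {x s : ℕ → Vec n}

/-- Along the damped phase the objective decreases by at least `0.017` per iteration. -/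
lemma damped_phase (hf : IsSelfConcordant 2 f) (hg : IsProperClosedConvex g)
    (hrun : IsRun f g 0.2 ε x s) (k : ℕ) (hk : ∀ j < k, 0.2 < decrement f x s j) :
    x k ∈ dom (objective f g) ∧
      (objective f g (x k)).toReal ≤ (objective f g (x 0)).toReal - 0.017 * k := by
  induction k with
  | zero => exact ⟨hrun.start, by simp⟩
  | succ k ih =>
    obtain ⟨hx, hF⟩ := ih fun j hj => hk j (by omega)
    have hns : ∀ j < k, ¬ StopsAt f 0.2 ε x s j := fun j hj h => h.1 (hk j (by omega))
    have hlk := hk k (by omega)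
    rw [hrun.damped k hns hlk]
    obtain ⟨h1, h2⟩ := damped_step hf hg hx (hrun.subproblem k hns) (l := decrement f x s k) rfl
    refine ⟨h1, h2.trans ?_⟩
    have := le_sub_log_one_add_of_lt hlk
    push_cast
    linarith

/-- Along the full-step phase the decrements decrease quadratically. -/
lemma full_phase (hf : IsSelfConcordant 2 f) (hg : IsProperClosedConvex g)
    (hrun : IsRun f g 0.2 ε x s) {N : ℕ} (hN : ∀ j < N, ¬ StopsAt f 0.2 ε x s j)
    (hx : x N ∈ dom (objective f g)) (hl : decrement f x s N ≤ 0.2) (m : ℕ)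
    (hm : ∀ j < m, ε < decrement f x s (N + j)) :
    (∀ j < N + m, ¬ StopsAt f 0.2 ε x s j) ∧
      (∀ i ≤ m, x (N + i) ∈ dom (objective f g)) ∧
      decrement f x s (N + m) ≤ 0.2 ∧
      decrement f x s (N + m) ≤ 0.64 * 0.3125 ^ (2 ^ m) := by
  induction m with
  | zero =>
    refine ⟨hN, fun i hi => ?_, hl, hl.trans (by norm_num)⟩
    obtain rfl : i = 0 := by omega
    exact hx
  | succ m ih =>
    obtain ⟨hns, hxm, h02, hb⟩ := ih fun j hj => hm j (by omega)
    have hε := hm m (by omega)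
    have hns' : ∀ j < N + (m + 1), ¬ StopsAt f 0.2 ε x s j := by
      intro j hj
      rcases Nat.lt_or_ge j (N + m) with h | h
      · exact hns j h
      · obtain rfl : j = N + m := by omega
        exact fun h => h.2 hε
    have hs := hrun.subproblem (N + m) hns
    have hs' := hrun.subproblem (N + (m + 1)) hns'
    have hstep : x (N + (m + 1)) = s (N + m) := by
      rw [← add_assoc, hrun.full (N + m) hns (not_lt.2 h02) hε, add_sub_cancel]
    have hl1 : decrement f x s (N + m) < 1 := h02.trans_lt (by norm_num)
    have hxf := ((mem_dom_objective hf.closedConvex hg).1 (hxm m le_rfl)).1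
    rw [hstep] at hs'
    have hdec := full_step_decrement_le hf hg hxf hs hs' (l := decrement f x s (N + m)) rfl hl1
    have hdec' : decrement f x s (N + (m + 1)) ≤
        (decrement f x s (N + m) / (1 - decrement f x s (N + m))) ^ 2 := by
      rw [decrement, hstep]; exact hdec
    have hmem := full_step_mem_dom hf hg (hxm m le_rfl) hs hl1
    have hl0 : 0 ≤ decrement f x s (N + m) := Real.sqrt_nonneg _
    generalize decrement f x s (N + m) = l at *
    have hq : l / (1 - l) ≤ 1.25 * l := by
      rw [div_le_iff₀ (by linarith)]; norm_num at *; nlinarith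
    have hq0 : 0 ≤ l / (1 - l) := div_nonneg hl0 (by linarith)
    have hsq : decrement f x s (N + (m + 1)) ≤ (1.25 * l) ^ 2 :=
      hdec'.trans (by gcongr)
    refine ⟨hns', fun i hi => ?_, hsq.trans ?_, hsq.trans ?_⟩
    · rcases Nat.lt_or_ge i (m + 1) with h | h
      · exact hxm i (by omega)
      · obtain rfl : i = m + 1 := by omega
        rw [hstep]
        exact hmem
    · norm_num at *; nlinarith
    -- With c = 1.5625 = 1.25², the bound reads cλ⁺ ≤ (cλ)²; 0.64 = 1/c and 0.3125 = 0.2 c.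
    · calc (1.25 * l) ^ 2 ≤ (1.25 * (0.64 * 0.3125 ^ (2 ^ m))) ^ 2 := by gcongr
        _ = 0.64 * 0.3125 ^ (2 ^ (m + 1)) := by
          rw [pow_succ 2 m, pow_mul, mul_pow, mul_pow]; ring

end Run
end ProxNewton

theorem mainTheorem3 {n : ℕ} (f g : Vec n → EReal)
    (hf : IsSelfConcordant 2 f) (hg : IsProperClosedConvex g)
    (xs : Vec n) (hxs : IsUniqueMinimizer (objective f g) xs)
    (ε : ℝ) (hε : 0 < ε) (hε_lt : ε < 0.28)
    (hε_phase : -1 ≤ 1.5 * Real.log (Real.log (0.28 / ε)))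
    (x s : ℕ → Vec n) (hrun : IsRun f g 0.2 ε x s) :
    ∃ k : ℕ,
      (k : ℤ) ≤ Kmax ((objective f g (x 0)).toReal - (objective f g xs).toReal) ε ∧
      (∀ j < k, ¬ StopsAt f 0.2 ε x s j) ∧ StopsAt f 0.2 ε x s k ∧
      (∀ j ≤ k, x j ∈ dom (objective f g)) ∧
      decrement f x s k ≤ ε ∧
      localNorm f xs (x k - xs) ≤ 2 * ε := by
  set gap := (objective f g (x 0)).toReal - (objective f g xs).toReal
  have hxsd : xs ∈ dom (objective f g) := (hxs.1 _).trans_lt hrun.start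
  obtain ⟨hxsf, hxsg⟩ := (mem_dom_objective hf.closedConvex hg).1 hxsd
  have hcount : ∀ k : ℕ, (∀ j < k, 0.2 < decrement f x s j) → (k : ℝ) ≤ gap / 0.017 := by
    intro k hk
    obtain ⟨h1, h2⟩ := damped_phase hf hg hrun k hk
    obtain ⟨h3, h4⟩ := (mem_dom_objective hf.closedConvex hg).1 h1
    have h5 := hxs.1 (x k)
    rw [coe_objective hf.closedConvex hg h3 h4, coe_objective hf.closedConvex hg hxsf hxsg,
      EReal.coe_le_coe_iff, ← toReal_objective hf.closedConvex hg h3 h4,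
      ← toReal_objective hf.closedConvex hg hxsf hxsg] at h5
    rw [le_div_iff₀ (by norm_num)]
    simp only [gap]
    linarith
  have hexN : ∃ N, decrement f x s N ≤ 0.2 := by
    by_contra! hcon
    obtain ⟨k, hk⟩ := exists_nat_gt (gap / 0.017)
    exact absurd (hcount k fun j _ => hcon j) (not_le.2 hk)
  classical
  -- No index before the first N with decrement at most 0.2 stops the run, so N is reached by damped
  -- steps alone.
  obtain ⟨N, hNl, hNmin⟩ : ∃ N, decrement f x s N ≤ 0.2 ∧ ∀ j < N, 0.2 < decrement f x s j :=
    ⟨Nat.find hexN, Nat.find_spec hexN, fun j hj => not_le.1 (Nat.find_min hexN hj)⟩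
  have hNs : ∀ j < N, ¬ StopsAt f 0.2 ε x s j := fun j hj h => h.1 (hNmin j hj)
  have hxN := (damped_phase hf hg hrun N hNmin).1
  have hfull := full_phase hf hg hrun hNs hxN hNl
  -- The +2 in `Kmax`: when m + 2 decrements exceed ε, the last has index N + m + 1, and the ln ln
  -- bound yields m. The case m = 1 is what `hε_phase` is for.
  have hcount' : ∀ m : ℕ, (∀ j < m, ε < decrement f x s (N + j)) →
      (m : ℝ) - 2 ≤ 1.5 * Real.log (Real.log (0.28 / ε)) := by
    intro m hm
    match m with
    | 0 => norm_num at *; linarith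
    | 1 => norm_num at *; linarith
    | m + 2 =>
      have h1 := (hfull (m + 1) fun j hj => hm j (by omega)).2.2.2
      have := natCast_le_log_log_of_lt hε ((hm (m + 1) (by omega)).trans_le h1)
      push_cast
      linarith
  have hexm : ∃ m, decrement f x s (N + m) ≤ ε := by
    by_contra! hcon
    obtain ⟨k, hk⟩ := exists_nat_gt (1.5 * Real.log (Real.log (0.28 / ε)) + 2)
    have := hcount' k fun j _ => hcon j
    linarith
  obtain ⟨m, hml, hmmin⟩ :
      ∃ m, decrement f x s (N + m) ≤ ε ∧ ∀ j < m, ε < decrement f x s (N + j) :=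
    ⟨Nat.find hexm, Nat.find_spec hexm, fun j hj => not_le.1 (Nat.find_min hexm hj)⟩
  obtain ⟨hns, hxm, h02, -⟩ := hfull m hmmin
  refine ⟨N + m, ?_, hns, ⟨not_lt.2 h02, not_lt.2 hml⟩, fun j hj => ?_, hml, ?_⟩
  · have h1 : (N : ℤ) ≤ ⌊gap / 0.017⌋ := Int.le_floor.2 (by exact_mod_cast hcount N hNmin)
    have h2 : (m : ℤ) - 2 ≤ ⌊1.5 * Real.log (Real.log (0.28 / ε))⌋ :=
      Int.le_floor.2 (by push_cast; exact hcount' m hmmin)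
    rw [Kmax]
    push_cast
    linarith
  · rcases le_total j N with h | h
    · exact (damped_phase hf hg hrun j fun i hi => hNmin i (by omega)).1
    · obtain ⟨i, rfl⟩ := Nat.exists_eq_add_of_le h
      exact hxm i (by omega)
  · have := localNorm_sub_minimizer_le hf hg hxs.1 (hxm m le_rfl) (hrun.subproblem _ hns)
      (l := decrement f x s (N + m)) rfl h02
    linarith
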